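/- Let $\Sigma=\{x,x^R,y,y^R\}$. An \emph{instance} of a word $p\in\Sigma^*$ over an alphabet $T$ is a word $h(p)$, where $h:\Sigma^*\to T^*$ is a morphism sending no letter to the empty word and such that $h(x^R)$ and $h(y^R)$ are the reversals of $h(x)$ and $h(y)$. An infinite word \emph{avoids} $p$ if none of its finite factors (blocks of consecutive letters) is an instance of $p$. A \emph{square} is an instance of $xx$, i.e. a word $uu$ with $u$ nonempty. A \emph{Fraenkel--Simpson word} is an infinite binary word ${\bf f}=f_0f_1f_2\cdots$ over $\{0,1\}$ containing no squares other than $00$, $11$ and $0101$. \textbf{Theorem.} Fraenkel--Simpson words exist; indeed there is an infinite binary word whose set of square factors is exactly $\{00,11,0101\}$. Every Fraenkel--Simpson word ${\bf f}$ avoids the pattern $xyxyx^R$, that is, ${\bf f}$ has no factor of the form $XYXYX^R$ with $X,Y$ nonempty binary words and $X^R$ the reversal of $X$. Moreover, $0101$ is a factor of ${\bf f}$ and is its only square factor of length at least $4$, and $1010$ is not a factor of ${\bf f}$. -/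

import Mathlib

/-- The alphabet `{x, x^R, y, y^R}` of binary patterns with reversal. -/
inductive PatternLetter where
  | x
  | xR
  | y
  | yR
  deriving DecidableEq

/-- A finite word over the alphabet `T_k = {0, 1, ..., k - 1}`. -/
abbrev Word (k : ℕ) := FreeMonoid (Fin k)

/-- A binary pattern with reversal: a word over `{x, x^R, y, y^R}`. -/
abbrev Pattern := FreeMonoid PatternLetter

/-- A morphism from patterns to words respects reversal if it sends `x^R` to the reversal of the
image of `x`, and `y^R` to the reversal of the image of `y`. -/
def RespectsReversal {k : ℕ} (h : Pattern →* Word k) : Prop :=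
  h (FreeMonoid.of PatternLetter.xR) = FreeMonoid.reverse (h (FreeMonoid.of PatternLetter.x)) ∧
  h (FreeMonoid.of PatternLetter.yR) = FreeMonoid.reverse (h (FreeMonoid.of PatternLetter.y))

/-- A morphism is non-erasing if no letter is mapped to the empty word. -/
def NonErasing {k : ℕ} (h : Pattern →* Word k) : Prop :=
  ∀ a : PatternLetter, h (FreeMonoid.of a) ≠ 1

/-- `w` is an instance of the pattern `p`: the image of `p` under some non-erasing morphism which
respects reversal. -/
def IsInstance {k : ℕ} (p : Pattern) (w : Word k) : Prop :=
  ∃ h : Pattern →* Word k, NonErasing h ∧ RespectsReversal h ∧ w = h p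

/-- `w` is a (finite, contiguous) factor of the infinite word `f 0, f 1, f 2, ...`. -/
def IsFactor {k : ℕ} (w : Word k) (f : ℕ → Fin k) : Prop :=
  ∃ i : ℕ, w = FreeMonoid.ofList ((List.range w.length).map fun j => f (i + j))

/-- The infinite word `f` avoids the pattern `p`: no factor of `f` is an instance of `p`. -/
def Avoids {k : ℕ} (f : ℕ → Fin k) (p : Pattern) : Prop :=
  ∀ w : Word k, IsFactor w f → ¬ IsInstance p w

/-- The pattern `x x`. -/
def patternXX : Pattern :=
  FreeMonoid.ofList [PatternLetter.x, PatternLetter.x]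

/-- The pattern `x y x y x^R`. -/
def patternXYXYXR : Pattern :=
  FreeMonoid.ofList
    [PatternLetter.x, PatternLetter.y, PatternLetter.x, PatternLetter.y, PatternLetter.xR]

/-- The set of squares (instances of `x x`, so nonempty words `u u`) which are factors of `f`. -/
def squareFactors {k : ℕ} (f : ℕ → Fin k) : Set (Word k) :=
  {w | IsFactor w f ∧ IsInstance patternXX w}

/-- The three squares `00`, `11` and `0101`. -/
def threeSquares : Set (Word 2) :=
  {FreeMonoid.ofList [0, 0], FreeMonoid.ofList [1, 1], FreeMonoid.ofList [0, 1, 0, 1]}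

/-- The defining property of the Fraenkel--Simpson binary sequence: it contains no squares other
than `00`, `11` and `0101`. -/
def IsFraenkelSimpson (f : ℕ → Fin 2) : Prop :=
  squareFactors f ⊆ threeSquares

/-! Existence: a square-free ternary word, the fixed point of Leech's 13-uniform morphism, is mapped
to binary by a 50-uniform morphism. In a `k`-uniform image, a square of period below `2 * k` lies in
the image of five consecutive letters, so a finite check rules it out or lists it. A longer square
contains a whole image block in its first half; synchronization makes its period a multiple of `k`,
and the square pulls back to the preimage (`exists_squareAt_of_uniformImage`). This gives
square-freeness of the ternary word by descent, then the binary statement.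

For an arbitrary Fraenkel–Simpson word, every binary word of length 19 has a square of period at
least two, so `0101` must occur. An instance of `xyxyx^R` begins with the square of `XY`, of period
at least two, hence `X = 0`, `Y = 1`; the factor `01010` then contains the forbidden square `1010`.
-/

section Words

variable {α : Type*}

/-- The word `f` has a square of period `p` starting at position `i`. -/
def SquareAt (f : ℕ → α) (i p : ℕ) : Prop :=
  ∀ j < p, f (i + j) = f (i + p + j)

/-! ### Decidable search for squares in lists -/

section Check

variable [DecidableEq α]

/-- Both lists have at least `p` entries and their first `p` entries agree. -/
def agreeUpTo : List α → List α → ℕ → Bool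
  | _, _, 0 => true
  | a :: s, b :: t, p + 1 => decide (a = b) && agreeUpTo s t p
  | _, _, _ + 1 => false

theorem agreeUpTo_of_getElem? :
    ∀ (p : ℕ) (s t : List α), (∀ j < p, ∃ a, s[j]? = some a ∧ t[j]? = some a) →
      agreeUpTo s t p = true
  | 0, s, t, _ => by simp [agreeUpTo]
  | p + 1, [], t, h => by simpa using h 0 (by omega)
  | p + 1, a :: s, [], h => by simpa using h 0 (by omega)
  | p + 1, a :: s, b :: t, h => by
    have h0 := h 0 (by omega)
    have := agreeUpTo_of_getElem? p s t fun j hj => by simpa using h (j + 1) (by omega)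
    simp_all [agreeUpTo]

/-- Each of the periods `p, ..., p + n - 1` of a square prefix of `s` is allowed by `ok`, where
`t` is `s` without its first `p` entries. -/
def checkPeriods (ok : ℕ → Bool) (s : List α) : List α → ℕ → ℕ → Bool
  | _, _, 0 => true
  | t, p, n + 1 => (!agreeUpTo s t p || ok p) && checkPeriods ok s t.tail (p + 1) n

theorem checkPeriods_spec (ok : ℕ → Bool) (s : List α) :
    ∀ (n p : ℕ) (t : List α), checkPeriods ok s t p n = true →
      ∀ q < n, agreeUpTo s (t.drop q) (p + q) = true → ok (p + q) = true
  | 0, _, _, _, q, hq, _ => absurd hq (by omega)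
  | n + 1, p, t, h, 0, _, ha => by
    simp only [checkPeriods, Bool.and_eq_true, Bool.or_eq_true] at h
    simp_all
  | n + 1, p, t, h, q + 1, hq, ha => by
    simp only [checkPeriods, Bool.and_eq_true, Bool.or_eq_true] at h
    have e : p + (q + 1) = p + 1 + q := by omega
    rw [e] at ha ⊢
    exact checkPeriods_spec ok s n (p + 1) t.tail h.2 q (by omega) (by simpa using ha)

/-- All squares in `s` starting at one of the first `n` positions with period at most `P` are
allowed by `ok`. -/
def checkSquares (ok : List α → ℕ → Bool) (P : ℕ) : List α → ℕ → Bool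
  | _, 0 => true
  | s, n + 1 => checkPeriods (ok s) s s.tail 1 P && checkSquares ok P s.tail n

theorem checkSquares_spec (ok : List α → ℕ → Bool) (P : ℕ) :
    ∀ (n : ℕ) (s : List α), checkSquares ok P s n = true → ∀ r < n, ∀ p, 0 < p → p ≤ P →
      agreeUpTo (s.drop r) (s.drop (r + p)) p = true → ok (s.drop r) p = true
  | 0, _, _, r, hr, _, _, _, _ => absurd hr (by omega)
  | n + 1, s, h, 0, _, p, h0, hp, ha => by
    simp only [checkSquares, Bool.and_eq_true] at h
    obtain ⟨q, rfl⟩ : ∃ q, p = 1 + q := ⟨p - 1, by omega⟩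
    refine checkPeriods_spec (ok s) s P 1 s.tail h.1 q (by omega) ?_
    simpa [Nat.add_comm] using ha
  | n + 1, s, h, r + 1, hr, p, h0, hp, ha => by
    simp only [checkSquares, Bool.and_eq_true] at h
    have := checkSquares_spec ok P n s.tail h.2 r (by omega) p h0 hp (by
      rw [List.drop_tail, List.drop_tail]
      rwa [show r + p + 1 = r + 1 + p by omega])
    rwa [List.drop_tail] at this

end Check

/-! ### Squares in uniform images -/

/-- `g` is the image of `f` under the `k`-uniform morphism `h`. -/
def IsUniformImage {β : Type*} (h : β → List α) (k : ℕ) (f : ℕ → β) (g : ℕ → α) : Prop :=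
  ∀ m, ∀ r < k, (h (f m))[r]? = some (g (k * m + r))

/-- The image under `h` of the factor of length `l` of `f` at position `n`. -/
def window {β : Type*} (h : β → List α) (f : ℕ → β) : ℕ → ℕ → List α
  | _, 0 => []
  | n, l + 1 => h (f n) ++ window h f (n + 1) l

section Uniform

variable {β : Type*} {h : β → List α} {k : ℕ} {f : ℕ → β} {g : ℕ → α}

theorem IsUniformImage.getElem?_window (hk : ∀ a, (h a).length = k)
    (hg : IsUniformImage h k f g) :
    ∀ (l n u : ℕ), u < k * l → (window h f n l)[u]? = some (g (k * n + u))
  | 0, _, _, hu => absurd hu (by omega)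
  | l + 1, n, u, hu => by
    rw [window]
    by_cases hlt : u < k
    · rw [List.getElem?_append_left (by rw [hk]; exact hlt)]
      exact hg n u hlt
    · rw [List.getElem?_append_right (by rw [hk]; omega), hk,
        hg.getElem?_window hk l (n + 1) (u - k) (by rw [Nat.mul_succ] at hu; omega)]
      congr 2
      rw [Nat.mul_succ]; omega

theorem IsUniformImage.agreeUpTo_of_squareAt [DecidableEq α] (hk : ∀ a, (h a).length = k)
    (hg : IsUniformImage h k f g) {n r p l : ℕ} (hl : r + 2 * p ≤ k * l)
    (hs : SquareAt g (k * n + r) p) :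
    agreeUpTo ((window h f n l).drop r) ((window h f n l).drop (r + p)) p = true := by
  refine agreeUpTo_of_getElem? _ _ _ fun j hj => ⟨g (k * n + r + j), ?_, ?_⟩
  · rw [List.getElem?_drop, hg.getElem?_window hk l n (r + j) (by omega), Nat.add_assoc]
  · rw [List.getElem?_drop, hg.getElem?_window hk l n (r + p + j) (by omega), hs j hj]
    congr 2; omega

/-- Five blocks suffice: the offset in the first block is at most `k - 1`, and `(k - 1) + 2 * (2 * k
- 1) < 5 * k`. -/
theorem IsUniformImage.ok_of_squareAt [DecidableEq α] (hk : ∀ a, (h a).length = k)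
    (hg : IsUniformImage h k f g) (ok : List α → ℕ → Bool)
    (hc : ∀ n, checkSquares ok (2 * k - 1) (window h f n 5) k = true)
    {i p : ℕ} (h0 : 0 < p) (hp : p ≤ 2 * k - 1) (hs : SquareAt g i p) :
    ok ((window h f (i / k) 5).drop (i % k)) p = true := by
  have hk0 : 0 < k := by omega
  have hr := Nat.mod_lt i hk0
  refine checkSquares_spec ok _ k _ (hc _) _ hr p h0 hp ?_
  refine hg.agreeUpTo_of_squareAt hk (by omega) ?_
  rwa [Nat.div_add_mod]

/-- The image of a letter occurs in the image of two distinct letters only at the start. -/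
def IsSynchronizing (h : β → List α) (k : ℕ) : Prop :=
  ∀ a b c, b ≠ c → ∀ r < k, ((h b ++ h c).drop r).take k = h a → r = 0

/-- No image of a letter is composed of a suffix and a prefix that it shares with the images of
other letters. -/
def IsSeparating (h : β → List α) (k : ℕ) : Prop :=
  ∀ a b c, ∀ r < k, (h a).drop r = (h b).drop r → (h b).take r = (h c).take r → a = b ∨ b = c

theorem exists_squareAt_of_uniformImage (hk : ∀ a, (h a).length = k)
    (hg : IsUniformImage h k f g) (hsync : IsSynchronizing h k) (hsep : IsSeparating h k)
    (hf : ∀ n, f n ≠ f (n + 1)) {i p : ℕ} (hk0 : 0 < k) (hp : 2 * k ≤ p)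
    (hs : SquareAt g i p) : ∃ q i', 0 < q ∧ p = k * q ∧ SquareAt f i' q := by
  set m := i / k with hm
  set r := i % k with hr
  have hrk : r < k := Nat.mod_lt i hk0
  have hi : i = k * m + r := (Nat.div_add_mod i k).symm
  -- Since `2 * k ≤ p`, block `m + 1` lies in the first half of the square. Its copy `p` places
  -- later must also start at a block boundary, so `k ∣ p`.
  obtain ⟨q, hq⟩ : ∃ q, p = k * q := by
    have hS : k * (m + 1) = k * m + k := Nat.mul_succ _ _
    have hdm := Nat.div_add_mod (k * (m + 1) + p) k
    have hlt := Nat.mod_lt (k * (m + 1) + p) hk0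
    set q := (k * (m + 1) + p) / k
    set u := (k * (m + 1) + p) % k with hu
    have h2 : ((h (f q) ++ h (f (q + 1))).drop u).take k = h (f (m + 1)) := by
      apply List.ext_getElem?
      intro j
      by_cases hj : j < k
      · have hw := hg.getElem?_window hk 2 q (u + j) (by omega)
        simp only [window, List.append_nil] at hw
        rw [List.getElem?_take_of_lt hj, List.getElem?_drop, hw, hg _ j hj]
        have := hs (k - r + j) (by omega)
        rw [show i + (k - r + j) = k * (m + 1) + j by omega] at this
        rw [this]
        congr 2; omega
      · rw [List.getElem?_eq_none (by simp; omega), List.getElem?_eq_none (by rw [hk]; omega)]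
    have hu0 := hsync _ _ _ (hf q) u hlt h2
    have : k ∣ k * (m + 1) + p := Nat.dvd_of_mod_eq_zero (hu ▸ hu0)
    exact (Nat.dvd_add_right (Dvd.intro _ rfl)).1 this
  have hq0 : 0 < q := by
    rcases Nat.eq_zero_or_pos q with rfl | h
    · simp at hq; omega
    · exact h
  have hblock : ∀ n t, t < k → k * m + r ≤ k * n + t → k * n + t < k * m + r + p →
      (h (f n))[t]? = (h (f (n + q)))[t]? := by
    intro n t ht h1 h2
    rw [hg n t ht, hg (n + q) t ht]
    have := hs (k * n + t - i) (by omega)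
    rw [show i + (k * n + t - i) = k * n + t by omega] at this
    rw [this, Nat.mul_add]
    congr 2; omega
  have hmid : ∀ j, 0 < j → j < q → f (m + j) = f (m + q + j) := by
    intro j hj0 hjq
    have e : h (f (m + j)) = h (f (m + j + q)) := by
      apply List.ext_getElem?
      intro t
      by_cases ht : t < k
      · have h1 : k * 1 ≤ k * j := Nat.mul_le_mul_left k hj0
        have h2 : k * (j + 1) ≤ k * q := Nat.mul_le_mul_left k hjq
        rw [Nat.mul_succ] at h2
        apply hblock _ _ ht <;> rw [Nat.mul_add] <;> omega
      · rw [List.getElem?_eq_none (by rw [hk]; omega), List.getElem?_eq_none (by rw [hk]; omega)]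
    rw [show m + q + j = m + j + q by omega]
    -- With cut position `0`, separation is injectivity of `h`.
    rcases hsep (f (m + j)) (f (m + j + q)) (f (m + j)) 0 hk0 (by simpa using e) (by simp) with e | e
    · exact e
    · exact e.symm
  have hsuf : (h (f m)).drop r = (h (f (m + q))).drop r := by
    apply List.ext_getElem?
    intro t
    rw [List.getElem?_drop, List.getElem?_drop]
    by_cases ht : r + t < k
    · have h2 : k * 1 ≤ k * q := Nat.mul_le_mul_left k hq0
      exact hblock _ _ ht (by omega) (by omega)
    · rw [List.getElem?_eq_none (by rw [hk]; omega), List.getElem?_eq_none (by rw [hk]; omega)]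
  have hpre : (h (f (m + q))).take r = (h (f (m + q + q))).take r := by
    apply List.ext_getElem?
    intro t
    by_cases ht : t < r
    · have h2 : k * 1 ≤ k * q := Nat.mul_le_mul_left k hq0
      rw [List.getElem?_take_of_lt ht, List.getElem?_take_of_lt ht]
      apply hblock _ _ (by omega) <;> rw [Nat.mul_add] <;> omega
    · rw [List.getElem?_eq_none (by simp; omega), List.getElem?_eq_none (by simp; omega)]
  -- Blocks `m`, `m + q`, `m + 2 * q` are those cut by the start, middle and end of the square.
  -- Equality of the first two gives a square at `m`; equality of the last two gives one at `m + 1`.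
  rcases hsep _ _ _ r hrk hsuf hpre with e | e
  · refine ⟨q, m, hq0, hq, fun j hj => ?_⟩
    rcases Nat.eq_zero_or_pos j with rfl | h
    · exact e
    · exact hmid j h hj
  · refine ⟨q, m + 1, hq0, hq, fun j hj => ?_⟩
    rcases Nat.lt_or_ge (j + 1) q with h | h
    · have := hmid (j + 1) (by omega) h
      rw [show m + 1 + j = m + (j + 1) by omega, this]
      congr 1; omega
    · rw [show m + 1 + j = m + q by omega, show m + 1 + q + j = m + q + q by omega]
      exact e

end Uniform

end Words

/-! ### A square-free ternary word -/

/-- Leech's square-free morphism. -/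
def leech : Fin 3 → List (Fin 3)
  | 0 => [0, 1, 2, 1, 0, 2, 1, 2, 0, 1, 2, 1, 0]
  | 1 => [1, 2, 0, 2, 1, 0, 2, 0, 1, 2, 0, 2, 1]
  | 2 => [2, 0, 1, 0, 2, 1, 0, 1, 2, 0, 1, 0, 2]

/-- The fixed point of `leech` starting with `0`. -/
def leechWord (n : ℕ) : Fin 3 :=
  -- The default of `getD` is never reached, as all images have length 13.
  if _h : n = 0 then 0 else (leech (leechWord (n / 13))).getD (n % 13) 0
termination_by n
decreasing_by omega

theorem length_leech : ∀ a, (leech a).length = 13 := by decide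

theorem isUniformImage_leechWord : IsUniformImage leech 13 leechWord leechWord := by
  intro m r hr
  have key : leechWord (13 * m + r) = (leech (leechWord m)).getD r 0 := by
    rw [leechWord]
    split_ifs with h
    · obtain ⟨rfl, rfl⟩ : m = 0 ∧ r = 0 := by omega
      rw [leechWord]; simp [leech]
    · rw [show (13 * m + r) / 13 = m by omega, show (13 * m + r) % 13 = r by omega]
  rw [key, List.getD_eq_getElem?_getD, List.getElem?_eq_getElem (by rw [length_leech]; exact hr)]
  rfl

/-- A word of length five without squares. -/
def squareFree5 (l : List (Fin 3)) : Bool :=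
  checkSquares (fun _ _ => false) 2 l 4

theorem squareFree5_leech : ∀ a b : Fin 3, a ≠ b → ∀ r < 13,
    squareFree5 (((leech a ++ leech b).drop r).take 5) = true := by decide +kernel

theorem ne_of_squareFree5 : ∀ a b c d e : Fin 3, squareFree5 [a, b, c, d, e] = true → a ≠ b := by
  decide +kernel

theorem checkSquares_leech : ∀ a b c d e : Fin 3, squareFree5 [a, b, c, d, e] = true →
    checkSquares (fun _ _ => false) 25
      (leech a ++ (leech b ++ (leech c ++ (leech d ++ (leech e ++ []))))) 13 = true := by
  decide +kernel

theorem isSynchronizing_leech : IsSynchronizing leech 13 := by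
  unfold IsSynchronizing; decide +kernel

theorem isSeparating_leech : IsSeparating leech 13 := by
  unfold IsSeparating; decide +kernel

/-- Five consecutive letters lie in the image of two consecutive letters, which are distinct by
induction. -/
theorem squareFree5_leechWord (n : ℕ) :
    squareFree5 [leechWord n, leechWord (n + 1), leechWord (n + 2), leechWord (n + 3),
      leechWord (n + 4)] = true := by
  induction n using Nat.strong_induction_on with
  | _ n ih =>
  have hne : leechWord (n / 13) ≠ leechWord (n / 13 + 1) := by
    -- At `n = 0` the index does not decrease, so the first two letters are computed.
    rcases Nat.eq_zero_or_pos n with rfl | hn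
    · rw [leechWord, leechWord]; simp [leechWord, leech]
    · exact ne_of_squareFree5 _ _ _ _ _ (ih (n / 13) (by omega))
  have := squareFree5_leech _ _ hne (n % 13) (by omega)
  convert this using 2
  apply List.ext_getElem?
  intro j
  by_cases hj : j < 5
  · have hw := isUniformImage_leechWord.getElem?_window length_leech 2 (n / 13) (n % 13 + j)
      (by omega)
    simp only [window, List.append_nil] at hw
    rw [List.getElem?_take_of_lt hj, List.getElem?_drop, hw, ← Nat.add_assoc, Nat.div_add_mod]
    interval_cases j <;> rfl
  · rw [List.getElem?_eq_none (by simp; omega), List.getElem?_eq_none (by simp; omega)]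

theorem not_squareAt_leechWord (p : ℕ) : 0 < p → ∀ i, ¬ SquareAt leechWord i p := by
  induction p using Nat.strong_induction_on with
  | _ p ih =>
  intro h0 i hs
  rcases Nat.lt_or_ge p 26 with h | h
  · have := isUniformImage_leechWord.ok_of_squareAt length_leech (fun _ _ => false)
      (fun n => checkSquares_leech _ _ _ _ _ (squareFree5_leechWord n)) h0 (by omega) hs
    simp at this
  · obtain ⟨q, i', hq, hpq, hs'⟩ := exists_squareAt_of_uniformImage length_leech
      isUniformImage_leechWord isSynchronizing_leech isSeparating_leech
      (fun n => ne_of_squareFree5 _ _ _ _ _ (squareFree5_leechWord n)) (by omega) h hs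
    exact ih q (by omega) hq i' hs'

/-! ### A binary image with three squares -/

/-- A morphism that maps square-free ternary words to binary words with no squares other than
`00`, `11` and `0101`; here `true` and `false` stand for `1` and `0`. -/
def threeSquareMorphism : Fin 3 → List Bool
  | 0 => [true, true, false, false, false, true, false, true, true, false, false, false, true, true,
      true, false, false, true, false, true, true, true, false, false, false, true, true, false,
      false, true, false, true, true, false, false, false, true, false, true, true, true, false,
      false, true, false, true, true, false, false, true]
  | 1 => [true, true, false, false, false, true, false, true, true, true, false, false, true, false,
      true, true, false, false, false, true, false, true, true, true, false, false, false, true,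
      true, false, false, true, false, true, true, false, false, false, true, true, true, false,
      false, true, false, true, true, false, false, true]
  | 2 => [true, true, false, false, false, true, true, false, false, true, false, true, true, true,
      false, false, false, true, false, true, true, false, false, false, true, true, true, false,
      false, true, false, true, true, false, false, false, true, false, true, true, true, false,
      false, true, false, true, true, false, false, true]

/-- The periods of the squares `00`, `11` and `0101` at the start of a list. -/
def allowedPeriod (s : List Bool) (p : ℕ) : Bool :=
  p == 1 || (p == 2 && (s[0]? == some false && s[1]? == some true))

theorem length_threeSquareMorphism : ∀ a, (threeSquareMorphism a).length = 50 := by decide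

theorem checkSquares_threeSquareMorphism : ∀ a b c d e : Fin 3,
    squareFree5 [a, b, c, d, e] = true →
    checkSquares allowedPeriod 99
      (threeSquareMorphism a ++ (threeSquareMorphism b ++ (threeSquareMorphism c ++
        (threeSquareMorphism d ++ (threeSquareMorphism e ++ []))))) 50 = true := by
  decide +kernel

theorem isSynchronizing_threeSquareMorphism : IsSynchronizing threeSquareMorphism 50 := by
  unfold IsSynchronizing; decide +kernel

theorem isSeparating_threeSquareMorphism : IsSeparating threeSquareMorphism 50 := by
  unfold IsSeparating; decide +kernel

/-- The image of `leechWord` under `threeSquareMorphism`. -/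
def threeSquareWord (n : ℕ) : Bool :=
  (threeSquareMorphism (leechWord (n / 50))).getD (n % 50) false

theorem isUniformImage_threeSquareWord :
    IsUniformImage threeSquareMorphism 50 leechWord threeSquareWord := by
  intro m r hr
  rw [threeSquareWord, show (50 * m + r) / 50 = m by omega, show (50 * m + r) % 50 = r by omega,
    List.getD_eq_getElem?_getD,
    List.getElem?_eq_getElem (by rw [length_threeSquareMorphism]; exact hr)]
  rfl

theorem squareAt_threeSquareWord {i p : ℕ} (h0 : 0 < p) (hs : SquareAt threeSquareWord i p) :
    p = 1 ∨ p = 2 ∧ threeSquareWord i = false ∧ threeSquareWord (i + 1) = true := by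
  rcases Nat.lt_or_ge p 100 with h | h
  · have hok := isUniformImage_threeSquareWord.ok_of_squareAt length_threeSquareMorphism
      allowedPeriod
      (fun n => checkSquares_threeSquareMorphism _ _ _ _ _ (squareFree5_leechWord n)) h0
      (by omega) hs
    have hw := fun j (hj : j < 2) => isUniformImage_threeSquareWord.getElem?_window
      length_threeSquareMorphism 5 (i / 50) (i % 50 + j) (by omega)
    have w0 := hw 0 (by omega)
    have w1 := hw 1 (by omega)
    rw [← Nat.add_assoc, Nat.div_add_mod] at w0 w1
    simp only [Nat.add_zero] at w0
    simpa [allowedPeriod, List.getElem?_drop, w0, w1] using hok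
  · obtain ⟨q, i', hq, -, hs'⟩ := exists_squareAt_of_uniformImage length_threeSquareMorphism
      isUniformImage_threeSquareWord isSynchronizing_threeSquareMorphism
      isSeparating_threeSquareMorphism
      (fun n => ne_of_squareFree5 _ _ _ _ _ (squareFree5_leechWord n)) (by omega) h hs
    exact absurd hs' (not_squareAt_leechWord q hq i')

/-! ### Squares forced in binary words -/

/-- Every binary word that extends the reversal of `w` by `n` letters has a square of period at
least two. -/
def squaresForced : ℕ → List (Fin 2) → Bool
  | 0, w => !checkPeriods (fun p => p == 1) w w.tail 1 9
  | n + 1, w => !checkPeriods (fun p => p == 1) w w.tail 1 9 ||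
      (squaresForced n (0 :: w) && squaresForced n (1 :: w))

/-- Periods up to 9 suffice in the search, since two periods must fit into 19 letters. -/
theorem squaresForced_nil : squaresForced 19 [] = true := by decide +kernel

theorem exists_agreeUpTo_of_checkPeriods (w : List (Fin 2)) :
    ∀ (n p : ℕ) (t : List (Fin 2)), checkPeriods (fun p => p == 1) w t p n = false →
      ∃ q, p + q ≠ 1 ∧ agreeUpTo w (t.drop q) (p + q) = true
  | 0, p, t, h => by simp [checkPeriods] at h
  | n + 1, p, t, h => by
    simp only [checkPeriods, Bool.and_eq_false_iff] at h
    rcases h with h | h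
    · exact ⟨0, by simp_all⟩
    · obtain ⟨q, h1, h2⟩ := exists_agreeUpTo_of_checkPeriods w n (p + 1) t.tail h
      refine ⟨q + 1, by omega, ?_⟩
      rw [show p + (q + 1) = p + 1 + q by omega]
      simpa using h2

theorem getElem?_of_agreeUpTo {α : Type*} [DecidableEq α] :
    ∀ (p : ℕ) (s t : List α), agreeUpTo s t p = true →
      ∀ j < p, ∃ a, s[j]? = some a ∧ t[j]? = some a
  | 0, _, _, _, j, hj => absurd hj (by omega)
  | p + 1, [], t, h, _, _ => by simp [agreeUpTo] at h
  | p + 1, a :: s, [], h, _, _ => by simp [agreeUpTo] at h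
  | p + 1, a :: s, b :: t, h, 0, _ => by
    simp only [agreeUpTo, Bool.and_eq_true, decide_eq_true_eq] at h
    exact ⟨a, by simp [h.1]⟩
  | p + 1, a :: s, b :: t, h, j + 1, hj => by
    simp only [agreeUpTo, Bool.and_eq_true] at h
    simpa using getElem?_of_agreeUpTo p s t h.2 j (by omega)

/-- The reversal of the prefix of length `n` of `f`. -/
def reversePrefix (f : ℕ → Fin 2) : ℕ → List (Fin 2)
  | 0 => []
  | n + 1 => f n :: reversePrefix f n

theorem getElem?_reversePrefix (f : ℕ → Fin 2) :
    ∀ n j a, (reversePrefix f n)[j]? = some a → j < n ∧ f (n - 1 - j) = a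
  | 0, j, a, h => by simp [reversePrefix] at h
  | n + 1, 0, a, h => by simpa [reversePrefix] using h
  | n + 1, j + 1, a, h => by
    have := getElem?_reversePrefix f n j a (by simpa [reversePrefix] using h)
    exact ⟨by omega, by rw [← this.2]; congr 1; omega⟩

theorem exists_squareAt_of_reversePrefix (f : ℕ → Fin 2) (n : ℕ)
    (h : checkPeriods (fun p => p == 1) (reversePrefix f n) (reversePrefix f n).tail 1 9 = false) :
    ∃ i p, 2 ≤ p ∧ SquareAt f i p := by
  obtain ⟨q, hq, ha⟩ := exists_agreeUpTo_of_checkPeriods _ _ _ _ h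
  have key := getElem?_of_agreeUpTo _ _ _ ha
  have hlast : 2 * (1 + q) ≤ n := by
    obtain ⟨a, -, h2⟩ := key q (by omega)
    rw [List.getElem?_drop, ← List.drop_one, List.getElem?_drop] at h2
    have := (getElem?_reversePrefix f n _ _ h2).1
    omega
  -- A square prefix of the reversed word is a square suffix of the prefix of `f`; offset `j` in the
  -- one is offset `q - j` in the other.
  refine ⟨n - 2 * (1 + q), 1 + q, by omega, fun j hj => ?_⟩
  obtain ⟨a, h1, h2⟩ := key (q - j) (by omega)
  rw [List.getElem?_drop, ← List.drop_one, List.getElem?_drop] at h2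
  have e1 := (getElem?_reversePrefix f n _ _ h1).2
  have e2 := (getElem?_reversePrefix f n _ _ h2).2
  rw [show n - 2 * (1 + q) + (1 + q) + j = n - 1 - (q - j) by omega, e1, ← e2]
  congr 1; omega

theorem exists_squareAt_of_squaresForced (f : ℕ → Fin 2) :
    ∀ n m, squaresForced n (reversePrefix f m) = true → ∃ i p, 2 ≤ p ∧ SquareAt f i p
  | 0, m, h => exists_squareAt_of_reversePrefix f m (by simpa [squaresForced] using h)
  | n + 1, m, h => by
    simp only [squaresForced, Bool.or_eq_true, Bool.and_eq_true, Bool.not_eq_true'] at h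
    rcases h with h | ⟨h0, h1⟩
    · exact exists_squareAt_of_reversePrefix f m h
    · refine exists_squareAt_of_squaresForced f n (m + 1) ?_
      rw [reversePrefix]
      rcases Fin.exists_fin_two.1 ⟨f m, rfl⟩ with e | e <;> rw [e] <;> assumption

/-! ### From factors and instances to positions -/

/-- The factor of length `n` of `f` at position `i`. -/
def factorAt {k : ℕ} (f : ℕ → Fin k) (i n : ℕ) : Word k :=
  FreeMonoid.ofList ((List.range n).map fun j => f (i + j))

theorem length_factorAt {k : ℕ} (f : ℕ → Fin k) (i n : ℕ) : (factorAt f i n).length = n := by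
  simp [factorAt, FreeMonoid.length]

theorem isFactor_iff {k : ℕ} {w : Word k} {f : ℕ → Fin k} :
    IsFactor w f ↔ ∃ i n, w = factorAt f i n := by
  constructor
  · rintro ⟨i, h⟩; exact ⟨i, _, h⟩
  · rintro ⟨i, n, rfl⟩; exact ⟨i, by rw [length_factorAt]; rfl⟩

theorem factorAt_add {k : ℕ} (f : ℕ → Fin k) (i m n : ℕ) :
    factorAt f i (m + n) = factorAt f i m * factorAt f (i + m) n := by
  simp only [factorAt, ← FreeMonoid.ofList_append, List.range_add, List.map_append, List.map_map]
  congr 3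
  funext j
  simp [Nat.add_assoc]

theorem factorAt_eq_factorAt_iff {k : ℕ} {f : ℕ → Fin k} {i j n : ℕ} :
    factorAt f i n = factorAt f j n ↔ ∀ t < n, f (i + t) = f (j + t) := by
  rw [factorAt, factorAt, FreeMonoid.ofList.injective.eq_iff, List.map_inj_left]
  simp

theorem isInstance_patternXX_iff {k : ℕ} {w : Word k} :
    IsInstance patternXX w ↔ ∃ u : Word k, u ≠ 1 ∧ w = u * u := by
  constructor
  · rintro ⟨h, hne, -, rfl⟩
    refine ⟨h (FreeMonoid.of .x), hne _, ?_⟩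
    rw [← map_mul]; rfl
  · rintro ⟨u, hu, rfl⟩
    have hr : FreeMonoid.reverse u ≠ 1 := by
      intro e
      apply hu
      rw [← FreeMonoid.length_eq_zero] at e ⊢
      simpa using e
    refine ⟨FreeMonoid.lift fun a => match a with
      | .x => u
      | .xR => FreeMonoid.reverse u
      | .y => u
      | .yR => FreeMonoid.reverse u, ?_, ?_, ?_⟩
    · intro a
      cases a <;> simpa [FreeMonoid.lift_eval_of]
    · simp [RespectsReversal, FreeMonoid.lift_eval_of]
    · simp [patternXX]

theorem mem_squareFactors_iff {k : ℕ} {f : ℕ → Fin k} {w : Word k} :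
    w ∈ squareFactors f ↔ ∃ i p, 0 < p ∧ SquareAt f i p ∧ w = factorAt f i (2 * p) := by
  rw [squareFactors, Set.mem_ofPred_eq, isFactor_iff, isInstance_patternXX_iff]
  constructor
  · rintro ⟨⟨i, n, rfl⟩, u, hu, e⟩
    have hn : n = u.length + u.length := by
      rw [← length_factorAt f i n, e, FreeMonoid.length_mul]
    subst hn
    refine ⟨i, u.length, ?_, ?_, by rw [two_mul]⟩
    · exact Nat.pos_of_ne_zero fun h => hu (FreeMonoid.length_eq_zero.1 h)
    · rw [factorAt_add] at e
      obtain ⟨e1, e2⟩ := List.append_inj e (length_factorAt f i u.length)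
      exact factorAt_eq_factorAt_iff.1 (e1.trans e2.symm)
  · rintro ⟨i, p, h0, hs, rfl⟩
    refine ⟨⟨i, _, rfl⟩, factorAt f i p, fun e => ?_, ?_⟩
    · rw [← FreeMonoid.length_eq_zero, length_factorAt] at e; omega
    · rw [two_mul, factorAt_add, ← factorAt_eq_factorAt_iff.2 hs]

theorem isFraenkelSimpson_iff {f : ℕ → Fin 2} :
    IsFraenkelSimpson f ↔
      ∀ i p, 0 < p → SquareAt f i p → p = 1 ∨ p = 2 ∧ f i = 0 ∧ f (i + 1) = 1 := by
  constructor
  · intro h i p h0 hs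
    have hmem := h (mem_squareFactors_iff.2 ⟨i, p, h0, hs, rfl⟩)
    rcases hmem with e | e | e <;>
    · have hl : 2 * p = _ := (length_factorAt f i (2 * p)).symm.trans (congrArg FreeMonoid.length e)
      first
        | (left; change 2 * p = 2 at hl; omega)
        | (right
           change 2 * p = 4 at hl
           obtain rfl : p = 2 := by omega
           have e' : [f i, f (i + 1), f (i + 2), f (i + 3)] = [0, 1, 0, 1] := e
           simp_all)
  · rintro h w hw
    obtain ⟨i, p, h0, hs, rfl⟩ := mem_squareFactors_iff.1 hw
    rcases h i p h0 hs with rfl | ⟨rfl, h1, h2⟩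
    · have e : f i = f (i + 1) := hs 0 (by omega)
      have e' : factorAt f i (2 * 1) = FreeMonoid.ofList [f i, f (i + 1)] := rfl
      rw [e', ← e]
      rcases Fin.exists_fin_two.1 ⟨f i, rfl⟩ with e | e <;> rw [e] <;> simp [threeSquares]
    · have e0 : f i = f (i + 2) := hs 0 (by omega)
      have e1 : f (i + 1) = f (i + 3) := hs 1 (by omega)
      have e' : factorAt f i (2 * 2) =
        FreeMonoid.ofList [f i, f (i + 1), f (i + 2), f (i + 3)] := rfl
      rw [e', ← e0, ← e1, h1, h2]
      simp [threeSquares]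

/-! ### Consequences for every Fraenkel–Simpson word -/

theorem IsFraenkelSimpson.exists_factorAt {f : ℕ → Fin 2} (hf : IsFraenkelSimpson f) :
    ∃ i, SquareAt f i 2 ∧ factorAt f i 4 = FreeMonoid.ofList [0, 1, 0, 1] := by
  obtain ⟨i, p, hp, hs⟩ := exists_squareAt_of_squaresForced f 19 0 squaresForced_nil
  rcases isFraenkelSimpson_iff.1 hf i p (by omega) hs with rfl | ⟨rfl, h1, h2⟩
  · omega
  · refine ⟨i, hs, ?_⟩
    have e0 : f i = f (i + 2) := hs 0 (by omega)
    have e1 : f (i + 1) = f (i + 3) := hs 1 (by omega)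
    have e' : factorAt f i 4 = FreeMonoid.ofList [f i, f (i + 1), f (i + 2), f (i + 3)] := rfl
    rw [e', ← e0, ← e1, h1, h2]

theorem IsFraenkelSimpson.not_isFactor {f : ℕ → Fin 2} (hf : IsFraenkelSimpson f) :
    ¬ IsFactor (FreeMonoid.ofList [1, 0, 1, 0]) f := by
  rintro ⟨i, e⟩
  have e' : [1, 0, 1, 0] = [f i, f (i + 1), f (i + 2), f (i + 3)] := e
  simp only [List.cons.injEq, and_true] at e'
  obtain ⟨h0, h1, h2, h3⟩ := e'
  have hs : SquareAt f i 2 := by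
    intro j hj
    interval_cases j
    · exact h0.symm.trans h2
    · exact h1.symm.trans h3
  rcases isFraenkelSimpson_iff.1 hf i 2 (by omega) hs with h | ⟨-, h, -⟩
  · omega
  · rw [← h0] at h; exact absurd h (by decide)

theorem IsFraenkelSimpson.avoids {f : ℕ → Fin 2} (hf : IsFraenkelSimpson f) :
    Avoids f patternXYXYXR := by
  rintro w hw ⟨h, hne, ⟨hR, -⟩, rfl⟩
  obtain ⟨i, n, e⟩ := isFactor_iff.1 hw
  set X := h (FreeMonoid.of .x) with hX
  set Y := h (FreeMonoid.of .y) with hY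
  have hp : h patternXYXYXR = X * Y * (X * Y) * FreeMonoid.reverse X := by
    rw [← hR, hX, hY]; simp only [← map_mul]; rfl
  have hXl : 0 < X.length := Nat.pos_of_ne_zero fun e => hne _ (FreeMonoid.length_eq_zero.1 e)
  have hYl : 0 < Y.length := Nat.pos_of_ne_zero fun e => hne _ (FreeMonoid.length_eq_zero.1 e)
  rw [hp] at e
  set p := X.length + Y.length with hpl
  have hn : n = 2 * p + X.length := by
    have := congrArg FreeMonoid.length e
    rw [length_factorAt] at this
    simp only [FreeMonoid.length_mul, FreeMonoid.length_reverse] at this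
    omega
  subst hn
  rw [factorAt_add] at e
  obtain ⟨e1, e2⟩ := List.append_inj e (by
    change FreeMonoid.length _ = FreeMonoid.length _
    simp only [FreeMonoid.length_mul, length_factorAt]; omega)
  rw [two_mul, factorAt_add] at e1
  obtain ⟨e3, e4⟩ := List.append_inj e1 (by
    change FreeMonoid.length _ = FreeMonoid.length _
    simp only [FreeMonoid.length_mul, length_factorAt]; omega)
  have hs : SquareAt f i p := factorAt_eq_factorAt_iff.1 (e3.symm.trans e4)
  rcases isFraenkelSimpson_iff.1 hf i p (by omega) hs with h1 | ⟨h1, h2, h3⟩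
  · omega
  -- Period two leaves one letter each for `X` and `Y`, so reversal is trivial and `f (i + 4) = f
  -- i`.
  · have hX1 : X.length = 1 := by omega
    obtain ⟨a, ha⟩ := FreeMonoid.length_eq_one.1 hX1
    rw [h1, hX1, ha] at e2
    have e5 : f (i + 4) = a := by
      have : [a] = [f (i + 2 * 2 + 0)] := e2
      simpa using this.symm
    have e6 : f i = a := by
      rw [h1, ha] at e3
      have : a :: Y.toList = [f i, f (i + 1)] := e3
      exact (List.cons.inj this).1.symm
    have s0 : f i = f (i + 2) := by simpa [h1] using hs 0 (by omega)
    have s1 : f (i + 1) = f (i + 3) := by simpa [h1] using hs 1 (by omega)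
    apply hf.not_isFactor
    refine ⟨i + 1, ?_⟩
    change [1, 0, 1, 0] = [f (i + 1), f (i + 2), f (i + 3), f (i + 4)]
    rw [← s0, ← s1, e5, ← e6, h2, h3]

theorem IsFraenkelSimpson.long_squareFactors {f : ℕ → Fin 2} (hf : IsFraenkelSimpson f) :
    {w ∈ squareFactors f | 4 ≤ w.length} = {FreeMonoid.ofList [0, 1, 0, 1]} := by
  ext w
  simp only [Set.mem_ofPred_eq, Set.mem_singleton_iff]
  constructor
  · rintro ⟨hw, hl⟩
    rcases hf hw with rfl | rfl | rfl
    · exact absurd hl (by decide)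
    · exact absurd hl (by decide)
    · rfl
  · rintro rfl
    obtain ⟨i, hs, e⟩ := hf.exists_factorAt
    exact ⟨mem_squareFactors_iff.2 ⟨i, 2, by omega, hs, e.symm⟩, le_rfl⟩

/-! ### The explicit witness -/

/-- The word `threeSquareWord` over the alphabet `Fin 2`. -/
def fraenkelSimpsonWord (n : ℕ) : Fin 2 :=
  if threeSquareWord n then 1 else 0

theorem isFraenkelSimpson_fraenkelSimpsonWord : IsFraenkelSimpson fraenkelSimpsonWord := by
  rw [isFraenkelSimpson_iff]
  intro i p h0 hs
  have hs' : SquareAt threeSquareWord i p := by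
    intro j hj
    have := hs j hj
    simp only [fraenkelSimpsonWord] at this
    revert this
    cases threeSquareWord (i + j) <;> cases threeSquareWord (i + p + j) <;> simp
  simpa [fraenkelSimpsonWord] using squareAt_threeSquareWord h0 hs'

theorem squareFactors_fraenkelSimpsonWord :
    squareFactors fraenkelSimpsonWord = threeSquares := by
  refine Set.Subset.antisymm isFraenkelSimpson_fraenkelSimpsonWord ?_
  have hv : ∀ r < 50, (threeSquareMorphism 0)[r]? = some (threeSquareWord r) := by
    intro r hr
    have := isUniformImage_threeSquareWord 0 r hr
    rw [leechWord] at this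
    simpa using this
  have hval : ∀ r b, r < 50 → (threeSquareMorphism 0)[r]? = some b → threeSquareWord r = b :=
    fun r b hr hb => Option.some.inj ((hv r hr).symm.trans hb)
  -- The word begins with `1100`, which supplies `11` and `00`.
  have v0 := hval 0 true (by omega) rfl
  have v1 := hval 1 true (by omega) rfl
  have v2 := hval 2 false (by omega) rfl
  have v3 := hval 3 false (by omega) rfl
  rintro w (rfl | rfl | rfl)
  · refine mem_squareFactors_iff.2 ⟨2, 1, by omega, ?_, ?_⟩
    · intro j hj
      interval_cases j
      simp [fraenkelSimpsonWord, v2, v3]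
    · change _ = FreeMonoid.ofList [fraenkelSimpsonWord 2, fraenkelSimpsonWord 3]
      simp [fraenkelSimpsonWord, v2, v3]
  · refine mem_squareFactors_iff.2 ⟨0, 1, by omega, ?_, ?_⟩
    · intro j hj
      interval_cases j
      simp [fraenkelSimpsonWord, v0, v1]
    · change _ = FreeMonoid.ofList [fraenkelSimpsonWord 0, fraenkelSimpsonWord 1]
      simp [fraenkelSimpsonWord, v0, v1]
  · obtain ⟨i, hs, e⟩ := isFraenkelSimpson_fraenkelSimpsonWord.exists_factorAt
    exact mem_squareFactors_iff.2 ⟨i, 2, by omega, hs, e.symm⟩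

theorem mainTheorem12 :
    (∃ f : ℕ → Fin 2, IsFraenkelSimpson f ∧ squareFactors f = threeSquares) ∧
    ∀ f : ℕ → Fin 2, IsFraenkelSimpson f →
      Avoids f patternXYXYXR ∧
      {w ∈ squareFactors f | 4 ≤ w.length} = {FreeMonoid.ofList [0, 1, 0, 1]} ∧
      ¬ IsFactor (FreeMonoid.ofList [1, 0, 1, 0]) f :=
  ⟨⟨fraenkelSimpsonWord, isFraenkelSimpson_fraenkelSimpsonWord,
    squareFactors_fraenkelSimpsonWord⟩,
    fun _ hf => ⟨hf.avoids, hf.long_squareFactors, hf.not_isFactor⟩⟩
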